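/- Consider an undiscounted Markov decision process with finite nonempty state space $\mathcal S$, finite nonempty action space $\mathcal A$, transition probabilities $P(s'\mid s,a)$ and rewards $r(s,a)\in\mathbb R$. A policy is a map $\pi$ assigning to each state $s$ a probability distribution $\pi(\cdot\mid s)$ on $\mathcal A$; it is deterministic if each $\pi(\cdot\mid s)$ is a point mass. Let $\mathcal P^\pi(s,s')=\sum_a\pi(a\mid s)P(s'\mid s,a)$, $r^\pi(s)=\sum_a\pi(a\mid s)r(s,a)$, $T^\pi V=r^\pi+\mathcal P^\pi V$, and $TV(s)=\max_{a}\{r(s,a)+\sum_{s'}P(s'\mid s,a)V(s')\}$ for $V\in\mathbb R^{\mathcal S}$. The average reward of $\pi$ is $g^\pi(s)=\liminf_{N\to\infty}\frac1N\mathbb E_\pi\big[\sum_{t=0}^{N-1}r(s_t,a_t)\,\big|\,s_0=s\big]$. A pair $(g,h)$ of vectors in $\mathbb R^{\mathcal S}$ is a solution of the modified Bellman equations if, for all $s$, \[\max_a\sum_{s'}P(s'\mid s,a)g(s')=g(s),\qquad \max_a\Big\{r(s,a)+\sum_{s'}P(s'\mid s,a)h(s')\Big\}=h(s)+g(s),\]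 and some policy attains both maxima simultaneously, i.e. $\mathcal P^{\pi}g=g$ and $r^\pi+\mathcal P^\pi h=h+g$ for some $\pi$. The MDP is weakly communicating if there is a set $C$ of states, closed under all actions, such that each state of $C$ is accessible from every other state of $C$ under some deterministic policy, and every state outside $C$ is transient under every policy. Let the MDP be weakly communicating, let $(g^\star,h^\star)$ be a solution of the modified Bellman equations, let $\mathbf 1\in\mathbb R^{\mathcal S}$ be the all-ones vector, and let $f\colon\mathbb R^{\mathcal S}\to\mathbb R$ be a continuous function with $f(x+c\mathbf 1)=f(x)+c$ for all $x\in\mathbb R^{\mathcal S}$ and $c\in\mathbb R$. Let $h^0\in\mathbb R^{\mathcal S}$ be arbitrary and let $(h^k)$ be generated by Relaxed Relative Value Iteration with $\lambda_k=1/2$, \[h^{k}=\tfrac12h^{k-1}+\tfrac12\big(Th^{k-1}-f(h^{k-1})\mathbf 1\big),\qquad k=1,2,\dots,\] and let $\pi_k$ be any greedy policy for $h^k$, i.e. $T^{\pi_k}h^k=Th^k$. Then for all $k\ge1$, \[\|g^\star-g^{\pi_k}\|_\infty\le\|Th^k-h^k-g^\star\|_\infty\le\frac{4}{\sqrt{\pi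 k}}\,\|h^0-h^\star\|_\infty,\] where $\pi=3.14159\ldots$ on the right-hand side. Moreover, there is $h^\infty\in\mathbb R^{\mathcal S}$ such that $(g^\star,h^\infty)$ is a solution of the modified Bellman equations, $h^k\to h^\infty$, and $f(h^k)\mathbf 1\to g^\star$ as $k\to\infty$. -/

import Mathlib

/-- A Markov decision process with finite state space `S`, finite action space `A`, transition
probabilities `P s a s' = P(s' | s, a)` and reward `r`. -/
structure MDP (S A : Type*) [Fintype S] where
  P : S → A → S → ℝ
  r : S → A → ℝ
  P_nonneg : ∀ s a s', 0 ≤ P s a s'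
  P_sum_one : ∀ s a, ∑ s', P s a s' = 1

/-- A (stationary, possibly randomized) policy; `prob s a = π(a | s)`. -/
structure MDP.Policy (S A : Type*) [Fintype A] where
  prob : S → A → ℝ
  nonneg : ∀ s a, 0 ≤ prob s a
  sum_one : ∀ s, ∑ a, prob s a = 1

namespace MDP

variable {S A : Type*} [Fintype S] [Fintype A]

/-- The policy that takes the action `d s` in the state `s`. -/
def Policy.deterministic [DecidableEq A] (d : S → A) : Policy S A where
  prob s a := if a = d s then 1 else 0
  nonneg s a := by split_ifs <;> norm_num
  sum_one s := by simp

variable (M : MDP S A)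

/-- `r^π`. -/
def policyReward (π : Policy S A) : S → ℝ :=
  fun s => ∑ a, π.prob s a * M.r s a

/-- The transition matrix `P^π`. -/
def transitionMatrix (π : Policy S A) : Matrix S S ℝ :=
  Matrix.of fun s s' => ∑ a, π.prob s a * M.P s a s'

/-- The Bellman consistency operator `T^π`. -/
def consistencyOp (π : Policy S A) (V : S → ℝ) : S → ℝ :=
  fun s => ∑ a, π.prob s a * (M.r s a + ∑ s', M.P s a s' * V s')

/-- The Bellman optimality operator `T`. -/
def bellmanOp [Nonempty A] (V : S → ℝ) : S → ℝ :=
  fun s => Finset.univ.sup' Finset.univ_nonempty fun a => M.r s a + ∑ s', M.P s a s' * V s'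

/-- `π` is greedy for `V`: `T^π V = T V`. -/
def IsGreedy [Nonempty A] (π : Policy S A) (V : S → ℝ) : Prop :=
  M.consistencyOp π V = M.bellmanOp V

/-- The probability, under `π` and started at `s`, of the trajectory
`(s_0, a_0), …, (s_n, a_n)` with `τ t = (s_t, a_t)`. -/
def trajectoryProb [DecidableEq S] (π : Policy S A) (s : S) {n : ℕ}
    (τ : Fin (n + 1) → S × A) : ℝ :=
  (if (τ 0).1 = s then 1 else 0) * (∏ t : Fin (n + 1), π.prob (τ t).1 (τ t).2) *
    ∏ t : Fin n, M.P (τ t.castSucc).1 (τ t.castSucc).2 (τ t.succ).1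

/-- The expected total reward `E_π [∑_{t = 0}^{n} r(s_t, a_t) | s_0 = s]` over `n + 1` steps. -/
def expectedTotalReward [DecidableEq S] (π : Policy S A) (s : S) (n : ℕ) : ℝ :=
  ∑ τ : Fin (n + 1) → S × A, M.trajectoryProb π s τ * ∑ t, M.r (τ t).1 (τ t).2

/-- The average reward `g^π(s) = liminf_{N → ∞} (1/N) E_π [∑_{t < N} r(s_t, a_t) | s_0 = s]`,
with the horizon written as `N = n + 1`. -/
noncomputable def averageReward [DecidableEq S] (π : Policy S A) : S → ℝ :=
  fun s => Filter.liminf (fun n : ℕ => 1 / ((n : ℝ) + 1) * M.expectedTotalReward π s n)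
    Filter.atTop

/-- `hitProb Q s n i` is the probability that the Markov chain with transition matrix `Q` started
at `i` visits `s` at some time `t` with `1 ≤ t ≤ n`. -/
def hitProb [DecidableEq S] (Q : Matrix S S ℝ) (s : S) : ℕ → S → ℝ
  | 0, _ => 0
  | n + 1, i => ∑ j, Q i j * (if j = s then 1 else hitProb Q s n j)

/-- `s` is transient for the chain `Q`: the probability of ever returning to `s` (the supremum over
`n` of the probabilities of returning within `n` steps) is less than one. -/
def IsTransient [DecidableEq S] (Q : Matrix S S ℝ) (s : S) : Prop :=
  (⨆ n, hitProb Q s n s) < 1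

/-- Weakly communicating: there is a closed set `C` of states, each accessible from each other
under some deterministic policy, and all states outside `C` are transient under every policy. -/
def IsWeaklyCommunicating [DecidableEq S] [DecidableEq A] : Prop :=
  ∃ C : Set S,
    (∀ s ∈ C, ∀ a, ∀ s' ∉ C, M.P s a s' = 0) ∧
    (∀ s ∈ C, ∀ s' ∈ C, ∃ (d : S → A) (n : ℕ),
      0 < (M.transitionMatrix (Policy.deterministic d) ^ n) s s') ∧
    ∀ s ∉ C, ∀ π : Policy S A, IsTransient (M.transitionMatrix π) s

/-- `(g, h)` is a solution of the modified Bellman equations: it satisfies both equations, and some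
policy attains the maximum in both of them simultaneously. -/
structure IsModifiedBellmanSolution [Nonempty A] (g h : S → ℝ) : Prop where
  gain_eq : ∀ s, (Finset.univ.sup' Finset.univ_nonempty fun a => ∑ s', M.P s a s' * g s') = g s
  bias_eq : ∀ s, (Finset.univ.sup' Finset.univ_nonempty fun a =>
    M.r s a + ∑ s', M.P s a s' * h s') = h s + g s
  exists_policy : ∃ π : Policy S A, (M.transitionMatrix π).mulVec g = g ∧
    M.policyReward π + (M.transitionMatrix π).mulVec h = h + g

/-- Relaxed Relative Value Iteration:
`h^k = λ_{k-1} h^{k-1} + (1 - λ_{k-1}) (T h^{k-1} - f(h^{k-1}) 1)`. -/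
noncomputable def relaxedRVI [Nonempty A] (f : (S → ℝ) → ℝ) (lam : ℕ → ℝ) (h0 : S → ℝ) :
    ℕ → S → ℝ
  | 0 => h0
  | k + 1 => lam k • relaxedRVI f lam h0 k +
      (1 - lam k) • (M.bellmanOp (relaxedRVI f lam h0 k) -
        f (relaxedRVI f lam h0 k) • (1 : S → ℝ))

end MDP

/-! Weak communication makes `gstar` a constant `c`. Then `T V = M.bellmanOp V - c • 1` is sup-norm
nonexpansive, fixes `hstar` and commutes with adding constants. Since `f` also respects such shifts,
`h k` differs from the averaged iterate `x (k+1) = (x k + T (x k)) / 2` only by a constant, and its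
residual `bellmanOp (h k) - h k - gstar` is `T (x k) - x k`.

The rate is that of averaged iterations of nonexpansive maps: the distances `‖x m - x n‖` and `‖x m
- T (x n)‖` obey the first-step inequalities of a fair random walk
(`norm_iterates_le_ballotWeight`), which gives a central binomial probability, bounded through
Wallis' product. Regularity and compactness then yield convergence of `x`, and a scalar recursion
gives that of the shift.

For the policy error, `T^π V` within `ε` of `V + c` gives, by iteration, `N`-step rewards within `N
ε + O(1)` of `N c` (`abs_averageReward_sub_le`). -/

open Filter Topology

/-! ### Ballot weights and the central binomial coefficient. -/

/-- The probability that a fair simple random walk makes `m` up-steps before it has gone down by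
`b + 1` from its start. -/
noncomputable def ballotWeight (m b : ℕ) : ℝ :=
  (∑ i ∈ Finset.range (b + 1), ((2 * m + b).choose (m + i) : ℝ)) / 2 ^ (2 * m + b)

theorem ballotWeight_zero_left (b : ℕ) : ballotWeight 0 b = 1 := by
  have h : (∑ i ∈ Finset.range (b + 1), (b.choose i : ℝ)) = 2 ^ b := by
    exact_mod_cast Nat.sum_range_choose b
  simp [ballotWeight, h]

theorem ballotWeight_succ_zero (m : ℕ) :
    ballotWeight (m + 1) 0 = 1 / 2 * ballotWeight m 1 := by
  have h : ((2 * m + 1 + 1).choose (m + 1) : ℝ)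
      = (2 * m + 1).choose m + (2 * m + 1).choose (m + 1) := by
    exact_mod_cast Nat.choose_succ_succ (2 * m + 1) m
  simp only [ballotWeight, Finset.sum_range_succ, Finset.sum_range_zero]
  rw [show 2 * (m + 1) + 0 = 2 * m + 1 + 1 by ring]
  simp only [add_zero, zero_add, h, pow_succ]
  ring

/-- First-step analysis of the walk, verified through Pascal's rule: an up-step lowers `m` and
raises `b`, a down-step lowers `b`. -/
theorem ballotWeight_succ_succ (m b : ℕ) :
    ballotWeight (m + 1) (b + 1)
      = 1 / 2 * (ballotWeight m (b + 2) + ballotWeight (m + 1) b) := by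
  have h : ∀ i : ℕ, ((2 * m + b + 2 + 1).choose (m + 1 + i) : ℝ)
      = (2 * m + b + 2).choose (m + i) + (2 * m + b + 2).choose (m + 1 + i) := by
    intro i
    rw [show m + 1 + i = m + i + 1 by ring]
    exact_mod_cast Nat.choose_succ_succ (2 * m + b + 2) (m + i)
  unfold ballotWeight
  rw [show 2 * (m + 1) + (b + 1) = 2 * m + b + 2 + 1 by ring,
    show 2 * (m + 1) + b = 2 * m + b + 2 by ring, show 2 * m + (b + 2) = 2 * m + b + 2 by ring]
  simp only [h, Finset.sum_add_distrib]
  rw [Finset.sum_range_succ (fun i => ((2 * m + b + 2).choose (m + i) : ℝ)) (b + 2),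
    Finset.sum_range_succ (fun i => ((2 * m + b + 2).choose (m + 1 + i) : ℝ)) (b + 1),
    show m + 1 + (b + 1) = m + (b + 2) by ring, pow_succ]
  field_simp
  ring

theorem ballotWeight_one_right (m : ℕ) :
    ballotWeight m 1 = 2 * ((m + 1).centralBinom / 4 ^ (m + 1)) := by
  have h := ballotWeight_succ_zero m
  have h2 : ballotWeight (m + 1) 0 = (m + 1).centralBinom / 4 ^ (m + 1) := by
    simp [ballotWeight, Nat.centralBinom, pow_mul]
    norm_num
  rw [← h2, h]
  ring

theorem centralBinom_div_four_pow_le {k : ℕ} (hk : 1 ≤ k) :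
    (k.centralBinom : ℝ) / 4 ^ k ≤ 1 / √(Real.pi * k) := by
  have hk' : (1 : ℝ) ≤ k := by exact_mod_cast hk
  have hpos : (0 : ℝ) < Real.pi * k := by positivity
  have hc : (0 : ℝ) < k.centralBinom := by exact_mod_cast k.centralBinom_pos
  have hW := Real.Wallis.le_W k
  rw [Real.Wallis.W_eq_factorial_ratio] at hW
  have hfac : ((2 * k).factorial : ℝ) = k.centralBinom * k.factorial ^ 2 := by
    have := Nat.choose_mul_factorial_mul_factorial (n := 2 * k) (k := k) (by omega)
    rw [show 2 * k - k = k by omega] at this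
    rw [← this, Nat.centralBinom]; push_cast; ring
  have hf0 : (k.factorial : ℝ) ≠ 0 := by positivity
  have hratio : (2 : ℝ) ^ (4 * k) * (k.factorial : ℝ) ^ 4 /
      (((2 * k).factorial : ℝ) ^ 2 * (2 * k + 1)) =
      (4 ^ k / (k.centralBinom : ℝ)) ^ 2 / (2 * k + 1) := by
    rw [hfac, show (2 : ℝ) ^ (4 * k) = (4 ^ k) ^ 2 by
      rw [← pow_mul, mul_comm k 2, show (4 : ℝ) = 2 ^ 2 by norm_num, ← pow_mul]; ring_nf]
    field_simp
  rw [hratio] at hW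
  have hsq : Real.pi * k ≤ (4 ^ k / (k.centralBinom : ℝ)) ^ 2 := by
    rw [le_div_iff₀ (by positivity)] at hW
    refine le_trans ?_ hW
    -- The lower bound in Wallis' product exceeds what is needed by exactly `π / (4 (k + 1))`.
    have : (2 * (k : ℝ) + 1) / (2 * k + 2) * (Real.pi / 2) * (2 * k + 1)
        = Real.pi * k + Real.pi / (4 * (k + 1)) := by
      field_simp; ring
    rw [this]
    have : 0 ≤ Real.pi / (4 * ((k : ℝ) + 1)) := by positivity
    linarith
  have hle : √(Real.pi * k) ≤ 4 ^ k / (k.centralBinom : ℝ) :=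
    Real.sqrt_le_iff.2 ⟨by positivity, hsq⟩
  have := one_div_le_one_div_of_le (Real.sqrt_pos.2 hpos) hle
  simpa using this

/-! ### Averaged iterations of nonexpansive maps. -/

section KrasnoselskiiMann

variable {E : Type*} [NormedAddCommGroup E] [NormedSpace ℝ E] {T : E → E} {x : ℕ → E} {p : E}

theorem norm_sub_fixedPoint_succ_le (hT : ∀ y z, ‖T y - T z‖ ≤ ‖y - z‖)
    (hx : ∀ k, x (k + 1) = (1 / 2 : ℝ) • x k + (1 / 2 : ℝ) • T (x k)) (hp : T p = p) (k : ℕ) :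
    ‖x (k + 1) - p‖ ≤ ‖x k - p‖ := by
  have h1 : x (k + 1) - p = (1 / 2 : ℝ) • (x k - p) + (1 / 2 : ℝ) • (T (x k) - T p) := by
    rw [hx, hp]; module
  have h2 := norm_add_le ((1 / 2 : ℝ) • (x k - p)) ((1 / 2 : ℝ) • (T (x k) - T p))
  rw [← h1, norm_smul, norm_smul] at h2
  have := hT (x k) p
  norm_num at h2
  linarith

theorem norm_midpoint_sub_le (a b c : E) :
    ‖(1 / 2 : ℝ) • a + (1 / 2 : ℝ) • b - c‖ ≤ 1 / 2 * (‖a - c‖ + ‖b - c‖) := by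
  have h1 : (1 / 2 : ℝ) • a + (1 / 2 : ℝ) • b - c
      = (1 / 2 : ℝ) • (a - c) + (1 / 2 : ℝ) • (b - c) := by module
  have h2 := norm_add_le ((1 / 2 : ℝ) • (a - c)) ((1 / 2 : ℝ) • (b - c))
  rw [← h1, norm_smul, norm_smul] at h2
  norm_num at h2 ⊢
  linarith

/-- Averaging in the second index bounds `‖x m - x (n+1)‖`, and averaging in the first index plus
nonexpansiveness bounds `‖x (m+1) - T (x n)‖`, both by the mean of the same two distances. This is
the ballot recursion; the diagonal `‖x m - x m‖ = 0` plays the absorbing barrier. -/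
theorem norm_iterates_le_ballotWeight (hT : ∀ y z, ‖T y - T z‖ ≤ ‖y - z‖)
    (hx : ∀ k, x (k + 1) = (1 / 2 : ℝ) • x k + (1 / 2 : ℝ) • T (x k)) {D : ℝ}
    (hd : ∀ n, ‖x 0 - x n‖ ≤ D) (he : ∀ n, ‖x 0 - T (x n)‖ ≤ D) (m : ℕ) :
    (∀ b, ‖x m - x (m + b + 1)‖ ≤ D * ballotWeight m b) ∧
      ∀ b, ‖x (m + 1) - T (x (m + 1 + b))‖ ≤ D * ballotWeight m (b + 1) := by
  have hd' : ∀ m n, ‖x m - x (n + 1)‖ ≤ 1 / 2 * (‖x m - x n‖ + ‖x m - T (x n)‖) := by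
    intro m n
    have := norm_midpoint_sub_le (x n) (T (x n)) (x m)
    rwa [← hx, norm_sub_rev, norm_sub_rev (x n), norm_sub_rev (T (x n))] at this
  have he' : ∀ m n, ‖x (m + 1) - T (x n)‖ ≤ 1 / 2 * (‖x m - T (x n)‖ + ‖x m - x n‖) := by
    intro m n
    have h1 := norm_midpoint_sub_le (x m) (T (x m)) (T (x n))
    rw [← hx] at h1
    have := hT (x m) (x n)
    linarith
  induction m with
  | zero =>
    refine ⟨fun b => by simpa [ballotWeight_zero_left] using hd _, fun b => ?_⟩
    rw [ballotWeight_zero_left]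
    have h1 := he' 0 (0 + 1 + b)
    have h2 := he (0 + 1 + b)
    have h3 := hd (0 + 1 + b)
    linarith
  | succ m ih =>
    have hP : ∀ b, ‖x (m + 1) - x (m + 1 + b + 1)‖ ≤ D * ballotWeight (m + 1) b := by
      intro b
      induction b with
      | zero =>
        have h1 := hd' (m + 1) (m + 1)
        have h2 := ih.2 0
        rw [ballotWeight_succ_zero]
        simp only [sub_self, norm_zero, add_zero, zero_add] at h1 h2 ⊢
        linarith
      | succ b ihb =>
        have h1 := hd' (m + 1) (m + 1 + (b + 1))
        have h2 := ih.2 (b + 1)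
        rw [ballotWeight_succ_succ]
        rw [← add_assoc] at h1 h2
        rw [← add_assoc]
        linarith
    refine ⟨hP, fun b => ?_⟩
    have h1 := he' (m + 1) (m + 1 + (b + 1))
    have h2 := ih.2 (b + 1)
    have h3 := hP b
    rw [ballotWeight_succ_succ, show m + 1 + 1 + b = m + 1 + (b + 1) by ring]
    rw [add_assoc] at h3
    linarith

/-- The sharp rate of asymptotic regularity of the averaged iteration of a nonexpansive map. -/
theorem norm_averaged_iterate_sub_map_le (hT : ∀ y z, ‖T y - T z‖ ≤ ‖y - z‖)
    (hx : ∀ k, x (k + 1) = (1 / 2 : ℝ) • x k + (1 / 2 : ℝ) • T (x k)) (hp : T p = p)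
    {k : ℕ} (hk : 1 ≤ k) :
    ‖T (x k) - x k‖ ≤ 4 / √(Real.pi * k) * ‖x 0 - p‖ := by
  have hanti : ∀ n, ‖x n - p‖ ≤ ‖x 0 - p‖ := fun n =>
    antitone_nat_of_succ_le (f := fun n => ‖x n - p‖)
      (norm_sub_fixedPoint_succ_le hT hx hp) (Nat.zero_le n)
  -- The diameter bound `D = 2 ‖x 0 - p‖` gives one factor 2 of the final 4;
  -- `ballotWeight_one_right` gives the other.
  have hd : ∀ n, ‖x 0 - x n‖ ≤ 2 * ‖x 0 - p‖ := by
    intro n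
    have h1 := norm_sub_le (x 0 - p) (x n - p)
    rw [sub_sub_sub_cancel_right] at h1
    linarith [hanti n]
  have he : ∀ n, ‖x 0 - T (x n)‖ ≤ 2 * ‖x 0 - p‖ := by
    intro n
    have h1 := norm_sub_le (x 0 - p) (T (x n) - p)
    rw [sub_sub_sub_cancel_right] at h1
    have h2 := hT (x n) p
    rw [hp] at h2
    linarith [hanti n]
  obtain ⟨m, rfl⟩ : ∃ m, k = m + 1 := ⟨k - 1, by omega⟩
  have h1 := (norm_iterates_le_ballotWeight hT hx hd he m).2 0
  rw [zero_add, add_zero, ballotWeight_one_right] at h1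
  have h2 := centralBinom_div_four_pow_le hk
  rw [norm_sub_rev]
  refine h1.trans ?_
  calc 2 * ‖x 0 - p‖ * (2 * ((m + 1).centralBinom / 4 ^ (m + 1)))
      ≤ 2 * ‖x 0 - p‖ * (2 * (1 / √(Real.pi * (m + 1 : ℕ)))) := by gcongr
    _ = 4 / √(Real.pi * (m + 1 : ℕ)) * ‖x 0 - p‖ := by ring

/-- By asymptotic regularity every cluster point `q` is fixed. Distances to a fixed point never
increase, so a subsequence approaching `q` drags the whole sequence along. -/
theorem exists_tendsto_averaged_iterate [ProperSpace E] (hT : ∀ y z, ‖T y - T z‖ ≤ ‖y - z‖)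
    (hx : ∀ k, x (k + 1) = (1 / 2 : ℝ) • x k + (1 / 2 : ℝ) • T (x k)) (hp : T p = p) :
    ∃ q, T q = q ∧ Tendsto x atTop (𝓝 q) := by
  have hanti : ∀ q, T q = q → Antitone fun n => ‖x n - q‖ := fun q hq =>
    antitone_nat_of_succ_le (norm_sub_fixedPoint_succ_le hT hx hq)
  have hTc : Continuous T :=
    (LipschitzWith.of_dist_le_mul (K := 1) fun y z => by
      simpa [dist_eq_norm] using hT y z).continuous
  have hreg : Tendsto (fun k => T (x k) - x k) atTop (𝓝 0) := by
    have hsqrt : Tendsto (fun k : ℕ => √(Real.pi * k)) atTop atTop :=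
      Real.tendsto_sqrt_atTop.comp
        (tendsto_natCast_atTop_atTop.const_mul_atTop Real.pi_pos)
    have hlim : Tendsto (fun k : ℕ => 4 / √(Real.pi * k) * ‖x 0 - p‖) atTop (𝓝 0) := by
      simpa using (hsqrt.const_div_atTop 4).mul_const ‖x 0 - p‖
    refine squeeze_zero_norm' ?_ hlim
    filter_upwards [eventually_ge_atTop 1] with k hk
    exact norm_averaged_iterate_sub_map_le hT hx hp hk
  obtain ⟨q, -, φ, hφ, hq⟩ := (isCompact_closedBall p ‖x 0 - p‖).tendsto_subseq (x := x)
    fun n => by simpa [dist_eq_norm] using hanti p hp (Nat.zero_le n)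
  have hTq : T q = q := by
    have h1 : Tendsto (fun k => T (x (φ k)) - x (φ k)) atTop (𝓝 (T q - q)) :=
      ((hTc.tendsto q).comp hq).sub hq
    exact sub_eq_zero.1 (tendsto_nhds_unique h1 (hreg.comp hφ.tendsto_atTop))
  refine ⟨q, hTq, tendsto_iff_norm_sub_tendsto_zero.2 ?_⟩
  have hsub : Tendsto (fun k => ‖x (φ k) - q‖) atTop (𝓝 0) :=
    tendsto_iff_norm_sub_tendsto_zero.1 hq
  rw [Metric.tendsto_atTop] at hsub ⊢
  intro ε hε
  obtain ⟨N, hN⟩ := hsub ε hε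
  refine ⟨φ N, fun n hn => ?_⟩
  have h1 := hN N le_rfl
  have h2 := hanti q hTq hn
  simp only [dist_zero_right, norm_norm] at h1 ⊢
  exact lt_of_le_of_lt h2 h1

end KrasnoselskiiMann

/-! ### Weighted averages and closed sets. -/

/-- Equality case of averaging. It supplies the minimum principle: extremal level sets of harmonic
functions are closed for the chain. -/
theorem eq_of_weighted_sum_le {ι : Type*} [Fintype ι] {w u : ι → ℝ} {m : ℝ} (hw : ∀ j, 0 ≤ w j)
    (hw1 : ∑ j, w j = 1) (hu : ∀ j, w j ≠ 0 → m ≤ u j) (hs : ∑ j, w j * u j ≤ m) {j : ι}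
    (hj : w j ≠ 0) : u j = m := by
  have hnn : ∀ i ∈ Finset.univ, 0 ≤ w i * (u i - m) := by
    intro i _
    by_cases hi : w i = 0
    · simp [hi]
    · exact mul_nonneg (hw i) (sub_nonneg.2 (hu i hi))
  have hsum : ∑ i, w i * (u i - m) = ∑ i, w i * u i - m := by
    simp only [mul_sub, Finset.sum_sub_distrib, ← Finset.sum_mul, hw1, one_mul]
  have h0 : ∑ i, w i * (u i - m) = 0 :=
    le_antisymm (by rw [hsum]; linarith) (Finset.sum_nonneg hnn)
  have h1 := (Finset.sum_eq_zero_iff_of_nonneg hnn).1 h0 j (Finset.mem_univ j)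
  rcases mul_eq_zero.1 h1 with h | h
  · exact absurd h hj
  · linarith

theorem weighted_sum_le {ι : Type*} [Fintype ι] {w u : ι → ℝ} {m : ℝ} (hw : ∀ j, 0 ≤ w j)
    (hw1 : ∑ j, w j = 1) (hu : ∀ j, u j ≤ m) : ∑ j, w j * u j ≤ m := by
  calc ∑ j, w j * u j ≤ ∑ j, w j * m :=
        Finset.sum_le_sum fun j _ => mul_le_mul_of_nonneg_left (hu j) (hw j)
    _ = m := by rw [← Finset.sum_mul, hw1, one_mul]

theorem Matrix.pow_apply_eq_zero_of_closed {S : Type*} [Fintype S] [DecidableEq S]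
    {Q : Matrix S S ℝ} {D : Set S} (hD : ∀ i ∈ D, ∀ j ∉ D, Q i j = 0) (n : ℕ) :
    ∀ i ∈ D, ∀ j ∉ D, (Q ^ n) i j = 0 := by
  induction n with
  | zero =>
    intro i hi j hj
    rw [pow_zero, Matrix.one_apply_ne]
    rintro rfl
    exact hj hi
  | succ n ih =>
    intro i hi j hj
    rw [pow_succ, Matrix.mul_apply]
    refine Finset.sum_eq_zero fun l _ => ?_
    by_cases hl : l ∈ D
    · rw [hD l hl j hj, mul_zero]
    · rw [ih i hi l hl, zero_mul]

namespace MDP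

/-! ### Recurrent states of finite chains. -/

section Chain

variable {S : Type*} [Fintype S] [DecidableEq S] {Q : Matrix S S ℝ}

theorem hitProb_le_one (hQ : ∀ i j, 0 ≤ Q i j) (hQ1 : ∀ i, ∑ j, Q i j = 1) (s : S) (n : ℕ) :
    ∀ i, hitProb Q s n i ≤ 1 := by
  induction n with
  | zero => intro i; simp [hitProb]
  | succ n ih =>
    intro i
    refine weighted_sum_le (hQ i) (hQ1 i) fun j => ?_
    split_ifs
    exacts [le_rfl, ih j]

theorem hitProb_le_succ (hQ : ∀ i j, 0 ≤ Q i j) (s : S) (n : ℕ) :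
    ∀ i, hitProb Q s n i ≤ hitProb Q s (n + 1) i := by
  induction n with
  | zero =>
    intro i
    simp only [hitProb]
    refine Finset.sum_nonneg fun j _ => mul_nonneg (hQ i j) ?_
    split_ifs <;> norm_num
  | succ n ih =>
    intro i
    rw [hitProb, hitProb]
    refine Finset.sum_le_sum fun j _ => mul_le_mul_of_nonneg_left ?_ (hQ i j)
    split_ifs
    exacts [le_rfl, ih j]

/-- A nonempty closed set of states of a finite Markov chain contains a recurrent state. -/
theorem exists_mem_not_isTransient (hQ : ∀ i j, 0 ≤ Q i j) (hQ1 : ∀ i, ∑ j, Q i j = 1)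
    (D : Set S) (hne : D.Nonempty) (hD : ∀ i ∈ D, ∀ j ∉ D, Q i j = 0) :
    ∃ s ∈ D, ¬ IsTransient Q s := by
  induction D using WellFoundedLT.induction with
  | ind D ih =>
  -- Induction on inclusion reduces to a minimal closed set, where every state turns out to be
  -- recurrent.
  by_cases hmin : ∃ D' : Set S, D' < D ∧ D'.Nonempty ∧ ∀ i ∈ D', ∀ j ∉ D', Q i j = 0
  · obtain ⟨D', hlt, hne', hD'⟩ := hmin
    obtain ⟨s, hs, hst⟩ := ih D' hlt hne' hD'
    exact ⟨s, hlt.le hs, hst⟩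
  have hmin' : ∀ D' : Set S, D' ⊆ D → D'.Nonempty → (∀ i ∈ D', ∀ j ∉ D', Q i j = 0) →
      D' = D := by
    intro D' hsub hne' hD'
    by_contra hneq
    exact hmin ⟨D', lt_of_le_of_ne hsub hneq, hne', hD'⟩
  obtain ⟨s, hs⟩ := hne
  refine ⟨s, hs, fun htr => ?_⟩
  set u : S → ℝ := fun i => ⨆ n, hitProb Q s n i with hu
  have hlim : ∀ i, Tendsto (fun n => hitProb Q s n i) atTop (𝓝 (u i)) := fun i =>
    tendsto_atTop_ciSup (monotone_nat_of_le_succ fun n => hitProb_le_succ hQ s n i)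
      ⟨1, by rintro _ ⟨n, rfl⟩; exact hitProb_le_one hQ hQ1 s n i⟩
  have hfix : ∀ i, u i = ∑ j, Q i j * (if j = s then 1 else u j) := by
    intro i
    refine tendsto_nhds_unique ((tendsto_add_atTop_iff_nat 1).2 (hlim i)) ?_
    simp only [hitProb]
    refine tendsto_finsetSum _ fun j _ => Tendsto.const_mul _ ?_
    split_ifs
    exacts [tendsto_const_nhds, hlim j]
  obtain ⟨i₀, hi₀, hi₀min⟩ := Set.exists_min_image D u (Set.toFinite D) ⟨s, hs⟩
  have hlt : u i₀ < 1 := lt_of_le_of_lt (hi₀min s hs) htr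
  -- At a minimiser of the hitting probability `u`, every successor attains the same minimum. As
  -- this is below 1, the successor cannot be `s`.
  have key : ∀ i ∈ D, u i = u i₀ → ∀ j, Q i j ≠ 0 →
      j ∈ D ∧ (if j = s then 1 else u j) = u i₀ := by
    intro i hi hui j hj
    have hmem : ∀ j, Q i j ≠ 0 → j ∈ D := fun j hj => by
      by_contra hjD
      exact hj (hD i hi j hjD)
    refine ⟨hmem j hj, eq_of_weighted_sum_le (hQ i) (hQ1 i)
      (u := fun j => if j = s then 1 else u j) (fun j hj => ?_) (by rw [← hfix, hui]) hj⟩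
    split_ifs
    exacts [hlt.le, hi₀min j (hmem j hj)]
  have key' : ∀ i ∈ D, u i = u i₀ → ∀ j, Q i j ≠ 0 → j ∈ D ∧ j ≠ s ∧ u j = u i₀ := by
    intro i hi hui j hj
    obtain ⟨h1, h2⟩ := key i hi hui j hj
    by_cases hjs : j = s
    · rw [if_pos hjs] at h2
      exact absurd h2 hlt.ne'
    · rw [if_neg hjs] at h2
      exact ⟨h1, hjs, h2⟩
  have hE : {i | i ∈ D ∧ u i = u i₀} = D := by
    refine hmin' _ (fun i hi => hi.1) ⟨i₀, hi₀, rfl⟩ ?_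
    rintro i ⟨hi, hui⟩ j hj
    by_contra hQij
    obtain ⟨h1, -, h2⟩ := key' i hi hui j hQij
    exact hj ⟨h1, h2⟩
  have hconst : ∀ i ∈ D, u i = u i₀ := fun i hi => (hE.ge hi).2
  obtain ⟨j, hj⟩ : ∃ j, Q s j ≠ 0 := by
    by_contra hcon
    push Not at hcon
    have := hQ1 s
    simp [hcon] at this
  obtain ⟨hjD, hjs, -⟩ := key' s hs (hconst s hs) j hj
  -- Minimality has made `u` constant on `D`, so `s` is never entered from `D`; removing it leaves a
  -- smaller closed set.
  have hE' : D \ {s} = D := by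
    refine hmin' _ Set.sdiff_subset ⟨j, hjD, hjs⟩ ?_
    rintro i ⟨hi, -⟩ l hl
    by_contra hQil
    obtain ⟨h1, h2, -⟩ := key' i hi (hconst i hi) l hQil
    exact hl ⟨h1, h2⟩
  exact (hE'.ge hs).2 rfl

end Chain

/-! ### Policy operators and constancy of the gain. -/

section Decision

variable {S A : Type*} [Fintype S] [Fintype A] (M : MDP S A)

theorem transitionMatrix_nonneg (π : Policy S A) (i j : S) : 0 ≤ M.transitionMatrix π i j :=
  Finset.sum_nonneg fun a _ => mul_nonneg (π.nonneg i a) (M.P_nonneg i a j)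

theorem transitionMatrix_sum_mul (π : Policy S A) (V : S → ℝ) (i : S) :
    ∑ j, M.transitionMatrix π i j * V j = ∑ a, π.prob i a * ∑ j, M.P i a j * V j := by
  simp only [transitionMatrix, Matrix.of_apply, Finset.sum_mul, Finset.mul_sum]
  rw [Finset.sum_comm]
  simp only [mul_assoc]

theorem transitionMatrix_sum_one (π : Policy S A) (i : S) :
    ∑ j, M.transitionMatrix π i j = 1 := by
  simpa [M.P_sum_one, π.sum_one] using M.transitionMatrix_sum_mul π (fun _ => 1) i

theorem consistencyOp_apply (π : Policy S A) (V : S → ℝ) (s : S) :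
    M.consistencyOp π V s = M.policyReward π s + ∑ j, M.transitionMatrix π s j * V j := by
  rw [transitionMatrix_sum_mul]
  simp only [consistencyOp, policyReward, mul_add, Finset.sum_add_distrib]

theorem consistencyOp_mono (π : Policy S A) {V W : S → ℝ} (h : ∀ s, V s ≤ W s) (s : S) :
    M.consistencyOp π V s ≤ M.consistencyOp π W s := by
  rw [consistencyOp_apply, consistencyOp_apply]
  gcongr with j
  exacts [M.transitionMatrix_nonneg π s j, h j]

theorem consistencyOp_add_const (π : Policy S A) (V : S → ℝ) (c : ℝ) (s : S) :
    M.consistencyOp π (fun s' => V s' + c) s = M.consistencyOp π V s + c := by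
  simp only [consistencyOp_apply, mul_add, Finset.sum_add_distrib, ← Finset.sum_mul,
    M.transitionMatrix_sum_one, one_mul, add_assoc]

theorem transitionMatrix_deterministic [DecidableEq A] (d : S → A) (s s' : S) :
    M.transitionMatrix (Policy.deterministic d) s s' = M.P s (d s) s' := by
  simp [transitionMatrix, Policy.deterministic]

section Gain

variable [DecidableEq S] [DecidableEq A] {M}

/-- The sets where `g` is minimal and maximal are closed under `π`, hence contain recurrent states,
which lie in `C`. Because `P g ≤ g` for all actions, the minimal set is closed under every policy,
yet some policy leads from it to the maximal one. -/
theorem IsWeaklyCommunicating.gain_const [Nonempty S]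
    (hM : M.IsWeaklyCommunicating) {g : S → ℝ}
    (hg : ∀ s a, ∑ s', M.P s a s' * g s' ≤ g s)
    {π : Policy S A} (hπ : (M.transitionMatrix π).mulVec g = g) :
    ∃ c : ℝ, ∀ s, g s = c := by
  obtain ⟨C, hcl, hacc, htr⟩ := hM
  have hπ' : ∀ s, ∑ j, M.transitionMatrix π s j * g j = g s := fun s => congrFun hπ s
  have hmeet : ∀ D : Set S, D.Nonempty → (∀ i ∈ D, ∀ j ∉ D, M.transitionMatrix π i j = 0) →
      ∃ s ∈ D, s ∈ C := by
    intro D hne hD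
    obtain ⟨s, hs, hst⟩ := exists_mem_not_isTransient (M.transitionMatrix_nonneg π)
      (M.transitionMatrix_sum_one π) D hne hD
    by_contra hcon
    push Not at hcon
    exact hst (htr s (hcon s hs) π)
  obtain ⟨smin, hsmin⟩ := Finite.exists_min g
  obtain ⟨smax, hsmax⟩ := Finite.exists_max g
  obtain ⟨t, ht, htC⟩ := hmeet {s | g s = g smin} ⟨smin, rfl⟩ (by
    intro i hi j hj
    by_contra hij
    exact hj (eq_of_weighted_sum_le (M.transitionMatrix_nonneg π i)
      (M.transitionMatrix_sum_one π i) (fun j _ => hsmin j) ((hπ' i).trans hi).le hij))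
  obtain ⟨t', ht', htC'⟩ := hmeet {s | g s = g smax} ⟨smax, rfl⟩ (by
    intro i hi j hj
    by_contra hij
    have := eq_of_weighted_sum_le (M.transitionMatrix_nonneg π i)
      (M.transitionMatrix_sum_one π i) (u := fun j => - g j) (m := - g smax)
      (fun j _ => neg_le_neg (hsmax j))
      (by simp only [mul_neg, Finset.sum_neg_distrib, hπ' i]; exact (neg_inj.2 hi).le) hij
    exact hj (neg_inj.1 this))
  obtain ⟨d, n, hdn⟩ := hacc t htC t' htC'
  have hclosed : ∀ i ∈ {s | g s = g smin}, ∀ j ∉ {s | g s = g smin},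
      M.transitionMatrix (Policy.deterministic d) i j = 0 := by
    intro i hi j hj
    rw [transitionMatrix_deterministic]
    by_contra hij
    exact hj (eq_of_weighted_sum_le (M.P_nonneg i (d i)) (M.P_sum_one i (d i))
      (fun j _ => hsmin j) ((hg i (d i)).trans hi.le) hij)
  have hmm : g smin = g smax := by
    by_contra hne
    refine hdn.ne' (Matrix.pow_apply_eq_zero_of_closed hclosed n t ht t' fun h => ?_)
    exact hne (Eq.trans (Eq.symm h) ht')
  exact ⟨g smin, fun s => le_antisymm (hmm ▸ hsmax s) (hsmin s)⟩

end Gain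

/-! ### The Bellman optimality operator. -/

section Bellman

variable [Nonempty A]

theorem le_bellmanOp (V : S → ℝ) (s : S) (a : A) :
    M.r s a + ∑ s', M.P s a s' * V s' ≤ M.bellmanOp V s :=
  Finset.le_sup' (fun a => M.r s a + ∑ s', M.P s a s' * V s') (Finset.mem_univ a)

theorem exists_bellmanOp_eq (V : S → ℝ) (s : S) :
    ∃ a, M.bellmanOp V s = M.r s a + ∑ s', M.P s a s' * V s' := by
  obtain ⟨a, -, ha⟩ := Finset.exists_mem_eq_sup' (Finset.univ_nonempty (α := A))
    fun a => M.r s a + ∑ s', M.P s a s' * V s'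
  exact ⟨a, ha⟩

theorem bellmanOp_sub_le {V W : S → ℝ} {c : ℝ} (h : ∀ s, V s - W s ≤ c) (s : S) :
    M.bellmanOp V s - M.bellmanOp W s ≤ c := by
  obtain ⟨a, ha⟩ := M.exists_bellmanOp_eq V s
  have h1 := M.le_bellmanOp W s a
  have h2 := weighted_sum_le (M.P_nonneg s a) (M.P_sum_one s a) h
  simp only [mul_sub, Finset.sum_sub_distrib] at h2
  linarith

theorem norm_bellmanOp_sub_le (V W : S → ℝ) :
    ‖M.bellmanOp V - M.bellmanOp W‖ ≤ ‖V - W‖ := by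
  have hle : ∀ V W : S → ℝ, ∀ s, V s - W s ≤ ‖V - W‖ := fun V W s =>
    (le_abs_self _).trans (norm_le_pi_norm (V - W) s)
  refine (pi_norm_le_iff_of_nonneg (norm_nonneg _)).2 fun s => ?_
  rw [Pi.sub_apply, Real.norm_eq_abs, abs_le]
  have h1 := M.bellmanOp_sub_le (hle V W) s
  have h2 := M.bellmanOp_sub_le (hle W V) s
  rw [norm_sub_rev] at h2
  exact ⟨by linarith, h1⟩

theorem bellmanOp_add_const (V : S → ℝ) (c : ℝ) :
    M.bellmanOp (V + c • (1 : S → ℝ)) = M.bellmanOp V + c • (1 : S → ℝ) := by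
  funext s
  have h1 := M.bellmanOp_sub_le (V := V + c • (1 : S → ℝ)) (W := V) (c := c) (by simp) s
  have h2 := M.bellmanOp_sub_le (V := V) (W := V + c • (1 : S → ℝ)) (c := -c) (by simp) s
  simp only [Pi.add_apply, Pi.smul_apply, Pi.one_apply, smul_eq_mul, mul_one]
  linarith

/-- Every policy preserves a constant gain, so a deterministic greedy policy attains both maxima. -/
theorem isModifiedBellmanSolution_const [DecidableEq A] {c : ℝ} {V : S → ℝ}
    (hV : ∀ s, M.bellmanOp V s = V s + c) :
    M.IsModifiedBellmanSolution (fun _ => c) V := by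
  refine ⟨fun s => ?_, hV, ?_⟩
  · simp [← Finset.sum_mul, M.P_sum_one]
  · choose d hd using M.exists_bellmanOp_eq V
    refine ⟨Policy.deterministic d, ?_, ?_⟩
    · funext s
      simp [Matrix.mulVec, dotProduct, ← Finset.sum_mul, M.transitionMatrix_sum_one]
    · funext s
      have h1 := hd s
      rw [hV] at h1
      simp only [Pi.add_apply, Matrix.mulVec, dotProduct, transitionMatrix_deterministic, h1]
      simp [policyReward, Policy.deterministic]

end Bellman

/-! ### Trajectory expectations and average reward. -/

section AverageReward

variable [DecidableEq S]

theorem trajectoryProb_cons (π : Policy S A) (s : S) {n : ℕ} (x : S × A)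
    (τ : Fin (n + 1) → S × A) :
    M.trajectoryProb π s (Fin.cons x τ : Fin (n + 1 + 1) → S × A)
      = (if x.1 = s then π.prob s x.2 else 0) *
        ∑ s', M.P s x.2 s' * M.trajectoryProb π s' τ := by
  have hsum : ∑ s', M.P s x.2 s' * M.trajectoryProb π s' τ
      = M.P s x.2 (τ 0).1 * ((∏ t : Fin (n + 1), π.prob (τ t).1 (τ t).2) *
        ∏ t : Fin n, M.P (τ t.castSucc).1 (τ t.castSucc).2 (τ t.succ).1) := by
    rw [Finset.sum_eq_single (τ 0).1]
    · simp [trajectoryProb]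
    · intro b _ hb
      simp [trajectoryProb, hb.symm]
    · simp
  have hprod : ∏ t : Fin (n + 1),
      M.P ((Fin.cons x τ : Fin (n + 1 + 1) → S × A) t.castSucc).1
        ((Fin.cons x τ : Fin (n + 1 + 1) → S × A) t.castSucc).2 (τ t).1
      = M.P x.1 x.2 (τ 0).1 *
        ∏ t : Fin n, M.P (τ t.castSucc).1 (τ t.castSucc).2 (τ t.succ).1 := by
    rw [Fin.prod_univ_succ]
    simp only [Fin.castSucc_zero, Fin.cons_zero, ← Fin.succ_castSucc, Fin.cons_succ]
  rw [hsum, trajectoryProb, Fin.prod_univ_succ]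
  simp only [Fin.cons_zero, Fin.cons_succ, hprod]
  split_ifs with h
  · rw [h]; ring
  · simp

theorem sum_cons {B : Type*} [Fintype B] {n : ℕ} (F : (Fin (n + 1) → B) → ℝ) :
    ∑ τ, F τ = ∑ x : B, ∑ τ : Fin n → B, F (Fin.cons x τ) := by
  rw [← Fintype.sum_prod_type', ← (Fin.consEquiv fun _ => B).sum_comp]
  rfl

/-- The Markov property: conditioning on the first action and next state turns trajectory sums into
iterates of `consistencyOp`. -/
theorem sum_trajectoryProb_mul_succ (π : Policy S A) (s : S) (n : ℕ)
    (F : (Fin (n + 1 + 1) → S × A) → ℝ) :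
    ∑ τ, M.trajectoryProb π s τ * F τ
      = ∑ a, π.prob s a * ∑ s', M.P s a s' *
        ∑ τ : Fin (n + 1) → S × A, M.trajectoryProb π s' τ * F (Fin.cons (s, a) τ) := by
  rw [sum_cons, Fintype.sum_prod_type, Finset.sum_eq_single s]
  · refine Finset.sum_congr rfl fun a _ => ?_
    simp only [trajectoryProb_cons, if_true, Finset.mul_sum, Finset.sum_mul]
    rw [Finset.sum_comm]
    simp only [mul_assoc]
  · intro b _ hb
    simp [trajectoryProb_cons, hb]
  · simp

theorem sum_trajectoryProb_mul_zero (π : Policy S A) (s : S) (F : (Fin (0 + 1) → S × A) → ℝ) :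
    ∑ τ, M.trajectoryProb π s τ * F τ = ∑ a, π.prob s a * F (fun _ => (s, a)) := by
  have hc : ∀ (x : S × A) (τ : Fin 0 → S × A),
      (Fin.cons x τ : Fin (0 + 1) → S × A) = fun _ => x := by
    intro x τ
    funext i
    rw [show i = 0 from Fin.fin_one_eq_zero i, Fin.cons_zero]
  rw [sum_cons, Fintype.sum_prod_type, Finset.sum_eq_single s]
  · simp [trajectoryProb, hc]
  · intro b _ hb
    simp [trajectoryProb, hb]
  · simp

theorem sum_trajectoryProb (π : Policy S A) (n : ℕ) :
    ∀ s, ∑ τ : Fin (n + 1) → S × A, M.trajectoryProb π s τ = 1 := by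
  induction n with
  | zero =>
    intro s
    simpa [π.sum_one] using M.sum_trajectoryProb_mul_zero π s fun _ => 1
  | succ n ih =>
    intro s
    simpa [π.sum_one, ih, M.P_sum_one] using M.sum_trajectoryProb_mul_succ π s n fun _ => 1

theorem expectedTotalReward_zero (π : Policy S A) (s : S) :
    M.expectedTotalReward π s 0 = M.policyReward π s := by
  rw [expectedTotalReward, sum_trajectoryProb_mul_zero]
  simp [policyReward]

theorem expectedTotalReward_succ (π : Policy S A) (s : S) (n : ℕ) :
    M.expectedTotalReward π s (n + 1)
      = M.consistencyOp π (fun s' => M.expectedTotalReward π s' n) s := by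
  rw [expectedTotalReward, sum_trajectoryProb_mul_succ, consistencyOp]
  refine Finset.sum_congr rfl fun a _ => ?_
  congr 1
  have h : ∀ s', ∑ τ : Fin (n + 1) → S × A, M.trajectoryProb π s' τ *
      ∑ t, M.r ((Fin.cons (s, a) τ : Fin (n + 1 + 1) → S × A) t).1
        ((Fin.cons (s, a) τ : Fin (n + 1 + 1) → S × A) t).2
      = M.r s a + M.expectedTotalReward π s' n := by
    intro s'
    simp only [Fin.sum_univ_succ (n := n + 1), Fin.cons_zero, Fin.cons_succ, mul_add,
      Finset.sum_add_distrib, ← Finset.sum_mul, M.sum_trajectoryProb, one_mul,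
      expectedTotalReward]
  simp only [h, mul_add, Finset.sum_add_distrib, ← Finset.sum_mul, M.P_sum_one, one_mul]

theorem expectedTotalReward_le {π : Policy S A} {V : S → ℝ} {b B : ℝ}
    (hV : ∀ s, M.consistencyOp π V s ≤ V s + b) (hB : ∀ s, -B ≤ V s) (n : ℕ) :
    ∀ s, M.expectedTotalReward π s n ≤ V s + ((n + 1) * b + B) := by
  induction n with
  | zero =>
    intro s
    -- The one-step reward is the operator applied to `0`, and `0 ≤ V + B`.
    have h1 := M.consistencyOp_mono π (V := fun _ => 0) (W := fun s => V s + B)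
      (fun s => by linarith [hB s]) s
    rw [consistencyOp_add_const, consistencyOp_apply] at h1
    rw [expectedTotalReward_zero]
    have h2 := hV s
    simp only [mul_zero, Finset.sum_const_zero, add_zero] at h1
    push_cast
    linarith
  | succ n ih =>
    intro s
    have h1 := M.consistencyOp_mono π ih s
    rw [consistencyOp_add_const] at h1
    rw [expectedTotalReward_succ]
    have h2 := hV s
    push_cast
    linarith

theorem le_expectedTotalReward {π : Policy S A} {V : S → ℝ} {b B : ℝ}
    (hV : ∀ s, V s + b ≤ M.consistencyOp π V s) (hB : ∀ s, V s ≤ B) (n : ℕ) :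
    ∀ s, V s + ((n + 1) * b - B) ≤ M.expectedTotalReward π s n := by
  induction n with
  | zero =>
    intro s
    have h1 := M.consistencyOp_mono π (W := fun _ => 0) (V := fun s => V s + -B)
      (fun s => by linarith [hB s]) s
    rw [consistencyOp_add_const, consistencyOp_apply (V := fun _ => 0)] at h1
    rw [expectedTotalReward_zero]
    have h2 := hV s
    simp only [mul_zero, Finset.sum_const_zero, add_zero] at h1
    push_cast
    linarith
  | succ n ih =>
    intro s
    have h1 := M.consistencyOp_mono π ih s
    rw [consistencyOp_add_const] at h1
    rw [expectedTotalReward_succ]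
    have h2 := hV s
    push_cast
    linarith

theorem abs_averageReward_sub_le {π : Policy S A} {V : S → ℝ} {c ε : ℝ}
    (hV : ∀ s, |M.consistencyOp π V s - V s - c| ≤ ε) (s : S) :
    |c - M.averageReward π s| ≤ ε := by
  have hB : ∀ s, |V s| ≤ ‖V‖ := norm_le_pi_norm V
  have hup : ∀ n : ℕ, 1 / ((n : ℝ) + 1) * M.expectedTotalReward π s n
      ≤ (c + ε) + 2 * ‖V‖ / (n + 1) := by
    intro n
    have h1 := M.expectedTotalReward_le (π := π) (V := V) (b := c + ε) (B := ‖V‖)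
      (fun s => by linarith [(abs_le.1 (hV s)).2]) (fun s => (abs_le.1 (hB s)).1) n s
    have h2 : (c + ε) + 2 * ‖V‖ / ((n : ℝ) + 1)
        = 1 / ((n : ℝ) + 1) * ((n + 1) * (c + ε) + 2 * ‖V‖) := by field_simp
    rw [h2]
    gcongr
    linarith [(abs_le.1 (hB s)).2]
  have hlow : ∀ n : ℕ, (c - ε) + -(2 * ‖V‖) / (n + 1)
      ≤ 1 / ((n : ℝ) + 1) * M.expectedTotalReward π s n := by
    intro n
    have h1 := M.le_expectedTotalReward (π := π) (V := V) (b := c - ε) (B := ‖V‖)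
      (fun s => by linarith [(abs_le.1 (hV s)).1]) (fun s => (abs_le.1 (hB s)).2) n s
    have h2 : (c - ε) + -(2 * ‖V‖) / ((n : ℝ) + 1)
        = 1 / ((n : ℝ) + 1) * ((n + 1) * (c - ε) + -(2 * ‖V‖)) := by field_simp
    rw [h2]
    gcongr
    linarith [(abs_le.1 (hB s)).1]
  have hlim : ∀ a K : ℝ, Tendsto (fun n : ℕ => a + K / ((n : ℝ) + 1)) atTop (𝓝 a) := by
    intro a K
    have h1 : Tendsto (fun n : ℕ => (n : ℝ) + 1) atTop atTop :=
      tendsto_atTop_add_const_right _ _ tendsto_natCast_atTop_atTop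
    simpa using (h1.const_div_atTop K).const_add a
  -- A real `liminf` is meaningful only for bounded sequences, so both bounds are needed for
  -- comparison.
  have hbdd_below := (hlim (c - ε) (-(2 * ‖V‖))).isBoundedUnder_ge.mono_ge
    (Eventually.of_forall hlow)
  have hbdd_above := (hlim (c + ε) (2 * ‖V‖)).isBoundedUnder_le.mono_le
    (Eventually.of_forall hup)
  have h1 : M.averageReward π s ≤ c + ε := by
    rw [← (hlim (c + ε) (2 * ‖V‖)).liminf_eq]
    exact liminf_le_liminf (Eventually.of_forall hup) hbdd_below
      (hlim _ _).isBoundedUnder_le.isCoboundedUnder_ge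
  have h2 : c - ε ≤ M.averageReward π s := by
    rw [← (hlim (c - ε) (-(2 * ‖V‖))).liminf_eq]
    exact liminf_le_liminf (Eventually.of_forall hlow) (hlim _ _).isBoundedUnder_ge
      hbdd_above.isCoboundedUnder_ge
  exact abs_le.2 ⟨by linarith, by linarith⟩

end AverageReward

end Decision

end MDP

/-! ### The scalar shift and the main theorem. -/

theorem tendsto_of_half_recursion {c u : ℕ → ℝ} {l : ℝ}
    (hc : ∀ k, c (k + 1) = 1 / 2 * c k + 1 / 2 * u k) (hu : Tendsto u atTop (𝓝 l)) :
    Tendsto c atTop (𝓝 l) := by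
  rw [Metric.tendsto_atTop] at hu ⊢
  intro ε hε
  obtain ⟨N, hN⟩ := hu (ε / 2) (by positivity)
  -- Past `N` the input error is below `ε / 2`, a level preserved by averaging, while the initial
  -- error halves.
  have hb : ∀ j, |c (N + j) - l| ≤ (1 / 2) ^ j * |c N - l| + ε / 2 := by
    intro j
    induction j with
    | zero => simp; positivity
    | succ j ih =>
      have h1 := hN (N + j) (by omega)
      rw [Real.dist_eq] at h1
      have h2 : c (N + (j + 1)) - l = 1 / 2 * (c (N + j) - l) + 1 / 2 * (u (N + j) - l) := by
        rw [← add_assoc, hc]; ring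
      have h3 := abs_add_le (1 / 2 * (c (N + j) - l)) (1 / 2 * (u (N + j) - l))
      rw [← h2, abs_mul, abs_mul, abs_of_pos (by norm_num : (0 : ℝ) < 1 / 2)] at h3
      rw [pow_succ]
      linarith
  have hpow : Tendsto (fun j : ℕ => (1 / 2 : ℝ) ^ j * |c N - l|) atTop (𝓝 0) := by
    simpa using (tendsto_pow_atTop_nhds_zero_of_lt_one (r := (1 / 2 : ℝ)) (by norm_num)
      (by norm_num)).mul_const |c N - l|
  obtain ⟨J, hJ⟩ := eventually_atTop.1 (hpow.eventually (gt_mem_nhds (half_pos hε)))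
  refine ⟨N + J, fun n hn => ?_⟩
  obtain ⟨j, rfl⟩ : ∃ j, n = N + j := ⟨n - N, by omega⟩
  have h1 := hb j
  have h2 := hJ j (by omega)
  rw [Real.dist_eq]
  linarith

theorem mainTheorem8 {S A : Type*} [Fintype S] [DecidableEq S] [Nonempty S]
    [Fintype A] [DecidableEq A] [Nonempty A]
    (M : MDP S A) (hM : M.IsWeaklyCommunicating)
    (f : (S → ℝ) → ℝ) (hf : Continuous f)
    (hf_shift : ∀ (x : S → ℝ) (c : ℝ), f (x + c • (1 : S → ℝ)) = f x + c)
    (h0 : S → ℝ) (h : ℕ → S → ℝ) (hh : h = M.relaxedRVI f (fun _ => 1 / 2) h0)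
    (gstar hstar : S → ℝ) (hsol : M.IsModifiedBellmanSolution gstar hstar) :
    (∀ k : ℕ, 1 ≤ k →
      (∀ π : MDP.Policy S A, M.IsGreedy π (h k) →
        ‖gstar - M.averageReward π‖ ≤ ‖M.bellmanOp (h k) - h k - gstar‖) ∧
      ‖M.bellmanOp (h k) - h k - gstar‖ ≤ 4 / Real.sqrt (Real.pi * k) * ‖h0 - hstar‖) ∧
    ∃ hinf : S → ℝ, M.IsModifiedBellmanSolution gstar hinf ∧
      Filter.Tendsto h Filter.atTop (nhds hinf) ∧
      Filter.Tendsto (fun k => f (h k) • (1 : S → ℝ)) Filter.atTop (nhds gstar) := by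
  obtain ⟨c, hc⟩ : ∃ c : ℝ, ∀ s, gstar s = c := by
    obtain ⟨π, hπ, -⟩ := hsol.exists_policy
    refine hM.gain_const (fun s a => ?_) hπ
    rw [← hsol.gain_eq s]
    exact Finset.le_sup' (fun a => ∑ s', M.P s a s' * gstar s') (Finset.mem_univ a)
  obtain rfl : gstar = c • (1 : S → ℝ) := by
    funext s
    simp [hc]
  set T : (S → ℝ) → S → ℝ := fun V => M.bellmanOp V - c • (1 : S → ℝ) with hTdef
  have hT : ∀ V W, ‖T V - T W‖ ≤ ‖V - W‖ := by
    intro V W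
    simpa [hTdef] using M.norm_bellmanOp_sub_le V W
  have hTshift : ∀ V (b : ℝ), T (V + b • (1 : S → ℝ)) = T V + b • (1 : S → ℝ) := by
    intro V b
    simp only [hTdef, M.bellmanOp_add_const]
    abel
  have hp : T hstar = hstar := by
    funext s
    have := hsol.bias_eq s
    change M.bellmanOp hstar s = _ at this
    simp [hTdef, this]
  -- The unshifted averaged iteration, from which `h` differs by multiples of `1`.
  let x : ℕ → S → ℝ := fun k =>
    Nat.rec h0 (fun _ y => (1 / 2 : ℝ) • y + (1 / 2 : ℝ) • T y) k
  have hx : ∀ k, x (k + 1) = (1 / 2 : ℝ) • x k + (1 / 2 : ℝ) • T (x k) := fun _ => rfl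
  -- Substituting `h = x + b • 1` in the iteration gives this recursion: the shifts of `T (h k)` and
  -- of `f (h k)` by `b k` cancel.
  let b : ℕ → ℝ := fun k => Nat.rec 0 (fun j y => 1 / 2 * y + 1 / 2 * (c - f (x j))) k
  have hb : ∀ k, b (k + 1) = 1 / 2 * b k + 1 / 2 * (c - f (x k)) := fun _ => rfl
  have hhx : ∀ k, h k = x k + b k • (1 : S → ℝ) := by
    intro k
    induction k with
    | zero => rw [hh]; simp [MDP.relaxedRVI, x, b]
    | succ k ih =>
      have hstep : h (k + 1) = (1 / 2 : ℝ) • h k +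
          (1 / 2 : ℝ) • (T (h k) + c • (1 : S → ℝ) - f (h k) • (1 : S → ℝ)) := by
        rw [hh]
        simp only [MDP.relaxedRVI, hTdef, sub_add_cancel]
        norm_num
      rw [hstep, ih, hTshift, hf_shift, hx, hb]
      module
  have hres : ∀ k, M.bellmanOp (h k) - h k - c • (1 : S → ℝ) = T (x k) - x k := by
    intro k
    have h1 : M.bellmanOp (h k) - h k - c • (1 : S → ℝ) = T (h k) - h k := by
      simp only [hTdef]; abel
    rw [h1, hhx, hTshift]
    abel
  refine ⟨fun k hk => ⟨fun π hπ => ?_, ?_⟩, ?_⟩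
  · refine (pi_norm_le_iff_of_nonneg (norm_nonneg _)).2 fun s => ?_
    have hV : ∀ s, |M.consistencyOp π (h k) s - h k s - c|
        ≤ ‖M.bellmanOp (h k) - h k - c • (1 : S → ℝ)‖ := by
      intro s
      have h1 := norm_le_pi_norm (M.bellmanOp (h k) - h k - c • (1 : S → ℝ)) s
      rw [hπ]
      simpa using h1
    simpa using M.abs_averageReward_sub_le hV s
  · rw [hres]
    exact norm_averaged_iterate_sub_map_le hT hx hp hk
  · obtain ⟨q, hq, hxq⟩ := exists_tendsto_averaged_iterate hT hx hp
    have hblim : Tendsto b atTop (𝓝 (c - f q)) :=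
      tendsto_of_half_recursion hb (((hf.tendsto q).comp hxq).const_sub c)
    have hlim : Tendsto h atTop (𝓝 (q + (c - f q) • (1 : S → ℝ))) := by
      rw [funext hhx]
      exact hxq.add (hblim.smul_const _)
    -- The limiting shift `c - f q` normalises `f` to `c` at the limit.
    refine ⟨q + (c - f q) • (1 : S → ℝ), ?_, hlim, ?_⟩
    · have hg : (c • (1 : S → ℝ)) = fun _ => c := by
        funext s
        simp
      rw [hg]
      refine M.isModifiedBellmanSolution_const fun s => ?_
      have h1 := hTshift q (c - f q)
      rw [hq] at h1
      have h2 := congrFun h1 s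
      simp only [hTdef, Pi.sub_apply, Pi.smul_apply, Pi.one_apply, smul_eq_mul, mul_one] at h2
      linarith
    · have h1 := (hf.tendsto _).comp hlim
      rw [hf_shift, add_sub_cancel] at h1
      exact h1.smul_const _
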